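/- Let $n$ players have non-empty closed convex action sets $S_i\subseteq\mathbb R^{k_i}$ and payoff functions $\pi_i$ on $S=S_1\times\dots\times S_n$. For $q\in S$ let $q_{-i}$ denote $q$ with its $i$-th component deleted. Let the best reply maps $f_i:\prod_{j\ne i}S_j\to S_i$ satisfy $\pi_i(q_i,q_{-i})<\pi_i(f_i(q_{-i}),q_{-i})$ for all $q\in S$ with $q_i\neq f_i(q_{-i})$, and let $q^*\in S$ be a Nash equilibrium, i.e. $q_i^*=f_i(q_{-i}^*)$ for all $i$. Call $\gamma:[0,\infty)\to[0,\infty)$ of class $\mathcal N$ if it is continuous, non-decreasing and $\gamma(0)=0$. Assume that there are $\tilde\gamma_{i,j}\in\mathcal N$ ($j\ne i$) with $$|f_i(q_{-i})-q_i^*|\le\max_{j\ne i}\tilde\gamma_{i,j}(|q_j-q_j^*|)\qquad\text{for all } q\in S,\ i=1,\dots,n$$ (a maximum over the empty set is $0$; $|\cdot|$ is the Euclidean norm). Let $0<r\le T$ and $0\le\Theta<1$ be constants, and consider the uncertain system, for $t>0$ and $i=1,\dots,n$, $$x_i(t)=\theta_i(t)\bigl(\mathrm{Pr}_{S_i}(x_i(t-\tau_i(t))+q_i^*)-q_i^*\bigr)+(1-\theta_i(t))\Bigl(f_i\bigl(\bigl(\mathrm{Pr}_{S_j}(q_j^*+d_{i,j}(t)\,\|x_j\|_{[t-T,t-r]})\bigr)_{j\ne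 i}\bigr)-q_i^*\Bigr),\qquad(3.7)$$ where $\mathrm{Pr}_U$ is the projection (nearest point map) on $U$, $\|y\|_{[a,b]}=\sup_{a\le s\le b}|y(s)|$, and the inputs are arbitrary functions $\theta_i:[0,\infty)\to[0,\Theta]$, $\tau_i:[0,\infty)\to[r,T]$ and $d_{i,j}:[0,\infty)\to\{d\in\mathbb R^{k_j}:|d|\le1\}$ ($j\ne i$). The $d_{i,j}$ encode arbitrary consistent backward-looking expectation rules, that is, expectations $q^{\exp}_{i,j}(t)=\mathrm{Pr}_{S_j}(q_j^*+d_{i,j}(t)\|x_j\|_{[t-T,t-r]})\in S_j$, which are exactly those with $|q^{\exp}_{i,j}(t)-q_j^*|\le\|x_j\|_{[t-T,t-r]}$. The state space $\mathcal X$ consists of the bounded functions $x_0:[-T,0]\to\mathbb R^{k_1+\dots+k_n}$ with the norm $\|x_0\|_{\mathcal X}=\sup_{[-T,0]}|x_0|$. A solution with initial condition $x_0\in\mathcal X$ is a function $x$ on $[-T,\infty)$ that equals $x_0$ on $[-T,0]$, satisfies (3.7) for all $t>0$ and has states $x_t=(x(t+s))_{s\in[-T,0]}\in\mathcal X$ for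 all $t\ge0$. Suppose that there is $\omega>1$ such that, with $\gamma_{i,j}(s)=\omega\tilde\gamma_{i,j}(\omega s)$, for each $p=2,\dots,n$ and all pairwise distinct $i_1,\dots,i_p\in\{1,\dots,n\}$, $$(\gamma_{i_1,i_2}\circ\gamma_{i_2,i_3}\circ\dots\circ\gamma_{i_p,i_1})(s)<s\qquad\text{for all } s>0 .$$ Then $0\in\mathcal X$ is robustly globally asymptotically stable for (3.7). That is: for every $x_0\in\mathcal X$ and all inputs there is exactly one solution; and, uniformly over all inputs, 1. for every $R\ge0$ there is $M$ such that $\|x_0\|_{\mathcal X}\le R$ implies $\|x_t\|_{\mathcal X}\le M$ for all $t\ge0$; 2. for every $\varepsilon>0$ there is $\delta>0$ such that $\|x_0\|_{\mathcal X}\le\delta$ implies $\|x_t\|_{\mathcal X}\le\varepsilon$ for all $t\ge0$; 3. for every $\varepsilon>0$ and $R\ge0$ there is $t_1\ge0$ such that $\|x_0\|_{\mathcal X}\le R$ implies $\|x_t\|_{\mathcal X}\le\varepsilon$ for all $t\ge t_1$. -/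

import Mathlib

open scoped NNReal

/-- `‖x‖_{[a,b]} = sup_{a ≤ s ≤ b} |x(s)|` (used only for `x` bounded on `[a,b]`, `a ≤ b`). -/
noncomputable def supNormOn {E : Type*} [Norm E] (x : ℝ → E) (a b : ℝ) : ℝ :=
  sSup ((fun s => ‖x s‖) '' Set.Icc a b)

/-- Class `𝒩`: non-decreasing continuous functions `ℝ⁺ → ℝ⁺` vanishing at `0`. -/
structure IsClassN (γ : ℝ≥0 → ℝ≥0) : Prop where
  monotone : Monotone γ
  continuous : Continuous γ
  map_zero : γ 0 = 0

/-- The composition `γ_{a,c₁} ∘ γ_{c₁,c₂} ∘ ⋯ ∘ γ_{c_m,b}` along `a, c₁, …, c_m, b`. -/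
def chainGain {ι : Type*} (γ : ι → ι → ℝ≥0 → ℝ≥0) : ι → List ι → ι → ℝ≥0 → ℝ≥0
  | a, [], b => γ a b
  | a, c :: l, b => γ a c ∘ chainGain γ c l b

/-- Cyclic small-gain conditions: for all pairwise distinct indices `i₁, …, i_p`, `p ≥ 2`
(here `i₁ = i` and `l = [i₂, …, i_p]`), `(γ_{i₁,i₂} ∘ ⋯ ∘ γ_{i_p,i₁})(s) < s` for all `s > 0`. -/
def CyclicSmallGain {ι : Type*} (γ : ι → ι → ℝ≥0 → ℝ≥0) : Prop :=
  ∀ (i : ι) (l : List ι), 2 ≤ (i :: l).length → (i :: l).Nodup →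
    ∀ s : ℝ≥0, 0 < s → chainGain γ i l i s < s

/-- Existence of a nearest point in a non-empty closed convex set. -/
theorem exists_nearest_point {m : ℕ} {U : Set (EuclideanSpace ℝ (Fin m))} (hne : U.Nonempty)
    (hcl : IsClosed U) (hcv : Convex ℝ U) (u : EuclideanSpace ℝ (Fin m)) :
    ∃ v : U, ∀ w : U, ‖u - v‖ ≤ ‖u - w‖ := by
  obtain ⟨v, hv, h⟩ := exists_norm_eq_iInf_of_complete_convex hne hcl.isComplete hcv u
  refine ⟨⟨v, hv⟩, fun w => ?_⟩
  rw [h]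
  exact ciInf_le ⟨0, by rintro _ ⟨z, rfl⟩; exact norm_nonneg _⟩ w

/-- The projection `Pr_U(u)`: the (unique) nearest point to `u` in the non-empty closed convex
set `U`. -/
noncomputable def convexProj {m : ℕ} {U : Set (EuclideanSpace ℝ (Fin m))} (hne : U.Nonempty)
    (hcl : IsClosed U) (hcv : Convex ℝ U) (u : EuclideanSpace ℝ (Fin m)) : U :=
  (exists_nearest_point hne hcl hcv u).choose

/-- An `n`-player game with closed convex action sets `S i ⊆ ℝ^{k i}` and payoff functions. -/
structure StrategicGame (n : ℕ) (k : Fin n → ℕ) where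
  S : ∀ i, Set (EuclideanSpace ℝ (Fin (k i)))
  nonempty : ∀ i, (S i).Nonempty
  isClosed : ∀ i, IsClosed (S i)
  convex : ∀ i, Convex ℝ (S i)
  payoff : Fin n → (∀ j, S j) → ℝ

namespace StrategicGame

variable {n : ℕ} {k : Fin n → ℕ} (G : StrategicGame n k)

/-- Outcomes `q = (q₁, …, q_n) ∈ S₁ × ⋯ × S_n`. -/
abbrev Outcome : Type := ∀ j, G.S j

/-- The type of families of maps `f_i : ∏_{j ≠ i} S_j → S_i`. -/
abbrev ReplyMap : Type := ∀ i, (∀ j : {j : Fin n // j ≠ i}, G.S j) → G.S i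

/-- The profile `q_{-i}` of the actions of the players other than `i`. -/
def others {G : StrategicGame n k} (q : G.Outcome) (i : Fin n) :
    ∀ j : {j : Fin n // j ≠ i}, G.S j := fun j => q j

/-- `f_i(q_{-i})` is the strict maximizer of `π_i(·, q_{-i})` on `S_i`. -/
def IsBestReply (f : G.ReplyMap) : Prop :=
  ∀ (i : Fin n) (q : G.Outcome) (y : G.S i), y ≠ f i (others q i) →
    G.payoff i (Function.update q i y) < G.payoff i (Function.update q i (f i (others q i)))

/-- `q` is a Nash equilibrium: `q_i = f_i(q_{-i})` for every player. -/
def IsNash (f : G.ReplyMap) (q : G.Outcome) : Prop :=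
  ∀ i, q i = f i (others q i)

/-- The projection on the action set of player `i`. -/
noncomputable def proj (i : Fin n) (u : EuclideanSpace ℝ (Fin (k i))) : G.S i :=
  convexProj (G.nonempty i) (G.isClosed i) (G.convex i) u

end StrategicGame

/-- The uncertain functions `θ_i : ℝ⁺ → [0,Θ]`, `τ_i : ℝ⁺ → [r,T]` and
`d_{i,j} : ℝ⁺ → {d ∈ ℝ^{k_j} : |d| ≤ 1}` (`j ≠ i`); values outside these ranges of the indices and
of time play no role. -/
structure UncertainInputs {n : ℕ} (k : Fin n → ℕ) (r T Θ : ℝ) where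
  θ : Fin n → ℝ → ℝ
  τ : Fin n → ℝ → ℝ
  d : ∀ _ j : Fin n, ℝ → EuclideanSpace ℝ (Fin (k j))
  θ_mem : ∀ i t, 0 ≤ t → θ i t ∈ Set.Icc 0 Θ
  τ_mem : ∀ i t, 0 ≤ t → τ i t ∈ Set.Icc r T
  d_le : ∀ i j t, j ≠ i → 0 ≤ t → ‖d i j t‖ ≤ 1

/-- Deviations live in `ℝ^{k₁ + ⋯ + k_n} = ℝ^{k₁} × ⋯ × ℝ^{k_n}` with its Euclidean norm. -/
abbrev Deviation {n : ℕ} (k : Fin n → ℕ) : Type :=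
  PiLp 2 fun i => EuclideanSpace ℝ (Fin (k i))

/-- The right-hand side of the `i`-th functional difference equation at time `t`. -/
noncomputable def fdeRhs {n : ℕ} {k : Fin n → ℕ} (G : StrategicGame n k) (f : G.ReplyMap)
    (qs : G.Outcome) {r T Θ : ℝ} (u : UncertainInputs k r T Θ) (x : ℝ → Deviation k)
    (t : ℝ) (i : Fin n) : EuclideanSpace ℝ (Fin (k i)) :=
  u.θ i t • ((G.proj i (x (t - u.τ i t) i + (qs i).1)).1 - (qs i).1)
    + (1 - u.θ i t) •
      ((f i fun j => G.proj j ((qs j).1 +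
          supNormOn (fun s => x s j) (t - T) (t - r) • u.d i j t)).1 - (qs i).1)

/-- `x`, of which only the restriction to `[-T, ∞)` matters, is the solution with initial
condition `x₀` (of which only the restriction to `[-T, 0]` matters): it agrees with `x₀` on
`[-T, 0]`, the states `x_t = x(t + ·)|_{[-T,0]}` are bounded functions for all `t ≥ 0`, and the
functional difference equations hold for all `t > 0`. -/
structure IsSolution {n : ℕ} {k : Fin n → ℕ} (G : StrategicGame n k) (f : G.ReplyMap)
    (qs : G.Outcome) {r T Θ : ℝ} (u : UncertainInputs k r T Θ) (x₀ x : ℝ → Deviation k) :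
    Prop where
  init : ∀ t ∈ Set.Icc (-T) 0, x t = x₀ t
  bounded : ∀ t, 0 ≤ t → BddAbove ((fun s => ‖x s‖) '' Set.Icc (t - T) t)
  eqn : ∀ t, 0 < t → ∀ i, x t i = fdeRhs G f qs u x t i

/-- `x₀` defines an element of the space `𝒳` of bounded functions on `[-T, 0]`, whose norm is
`supNormOn x₀ (-T) 0`. -/
def IsInitialState {n : ℕ} {k : Fin n → ℕ} (T : ℝ) (x₀ : ℝ → Deviation k) : Prop :=
  BddAbove ((fun s => ‖x₀ s‖) '' Set.Icc (-T) 0)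

/-- Robust global asymptotic stability of `0 ∈ 𝒳`, uniformly in the uncertain inputs: every
initial state and all inputs give exactly one solution on `[-T, ∞)`, and the solutions are
uniformly Lagrange stable, uniformly Lyapunov stable and uniformly attracted by `0`, where
`‖x_t‖_𝒳 = supNormOn x (t - T) t`. The system is autonomous, so the initial time is `0`. -/
structure IsRGAS {n : ℕ} {k : Fin n → ℕ} (G : StrategicGame n k) (f : G.ReplyMap)
    (qs : G.Outcome) (r T Θ : ℝ) : Prop where
  exists_solution : ∀ (u : UncertainInputs k r T Θ) (x₀ : ℝ → Deviation k),
    IsInitialState T x₀ → ∃ x, IsSolution G f qs u x₀ x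
  unique_solution : ∀ (u : UncertainInputs k r T Θ) (x₀ x y : ℝ → Deviation k),
    IsInitialState T x₀ → IsSolution G f qs u x₀ x → IsSolution G f qs u x₀ y →
      ∀ t, -T ≤ t → x t = y t
  lagrange : ∀ R : ℝ, 0 ≤ R → ∃ M : ℝ, ∀ (u : UncertainInputs k r T Θ) (x₀ x : ℝ → Deviation k),
    IsInitialState T x₀ → supNormOn x₀ (-T) 0 ≤ R → IsSolution G f qs u x₀ x →
      ∀ t, 0 ≤ t → supNormOn x (t - T) t ≤ M
  lyapunov : ∀ ε : ℝ, 0 < ε → ∃ δ : ℝ, 0 < δ ∧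
    ∀ (u : UncertainInputs k r T Θ) (x₀ x : ℝ → Deviation k),
      IsInitialState T x₀ → supNormOn x₀ (-T) 0 ≤ δ → IsSolution G f qs u x₀ x →
        ∀ t, 0 ≤ t → supNormOn x (t - T) t ≤ ε
  attractive : ∀ ε R : ℝ, 0 < ε → 0 ≤ R → ∃ t₁ : ℝ, 0 ≤ t₁ ∧
    ∀ (u : UncertainInputs k r T Θ) (x₀ x : ℝ → Deviation k),
      IsInitialState T x₀ → supNormOn x₀ (-T) 0 ≤ R → IsSolution G f qs u x₀ x →
        ∀ t, t₁ ≤ t → supNormOn x (t - T) t ≤ ε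

/-!
Scaling by `ω` turns the cyclic small-gain condition into a strict contraction. For the gains
`s ↦ ω γ̃_{i,j}(ω s)`, let `σ_i` be the largest gain along the simple paths starting at `i`.
Prepending an edge to a simple path gives either a simple path or one that closes a cycle, and a
cycle does not increase any value; so the gain operator does not increase `σ`. Hence `γ̃` maps the
curve `ω σ(s)` below `ω⁻² · (ω σ(s))`.

Since projections onto convex sets do not increase the distance to `q*`, the norms `‖x_i(t)‖`
satisfy a delay inequality with gains `γ̃`. The boxes bounded by `ω σ(s)` are therefore invariant,
which gives both stability properties. A solution in the box with parameter `s` enters, at the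
rate `Θ ^ m` and after a time independent of the inputs, any box with parameter `s'` such that
`κ ω σ(s) ≤ ω σ(s')`, for a fixed `κ ∈ (ω⁻², 1)`. By continuity of `σ` the infimum of the
parameters reached in this way is `0`, which is uniform attractivity.

Values at time `t > 0` depend only on the solution up to time `t - r`, so well-founded recursion
in steps of length `r` yields existence and uniqueness.
-/

open Filter Topology

section GainPaths

variable {ι : Type*} {γ : ι → ι → ℝ≥0 → ℝ≥0}

namespace IsClassN

variable {γ₁ γ₂ : ℝ≥0 → ℝ≥0}

theorem comp (h₁ : IsClassN γ₁) (h₂ : IsClassN γ₂) : IsClassN (γ₁ ∘ γ₂) :=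
  ⟨h₁.monotone.comp h₂.monotone, h₁.continuous.comp h₂.continuous, by
    rw [Function.comp_apply, h₂.map_zero, h₁.map_zero]⟩

theorem const_mul (a : ℝ≥0) : IsClassN (a * ·) :=
  ⟨fun _ _ h => mul_le_mul_right h a, continuous_const.mul continuous_id, mul_zero a⟩

theorem finset_sup {α : Type*} {A : Finset α} {g : α → ℝ≥0 → ℝ≥0}
    (hg : ∀ a ∈ A, IsClassN (g a)) : IsClassN fun s => A.sup fun a => g a s :=
  ⟨fun _ _ h => Finset.sup_mono_fun fun a ha => (hg a ha).monotone h,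
    Continuous.finset_sup_apply fun a ha => (hg a ha).continuous,
    le_antisymm (Finset.sup_le fun a ha => (hg a ha).map_zero.le) zero_le⟩

end IsClassN

/-- The composition `γ_{a,c₁} ∘ γ_{c₁,c₂} ∘ ⋯ ∘ γ_{c_{m-1},c_m}` of the gains along the path
`a, c₁, …, c_m`. Unlike in `chainGain`, the path may consist of `a` alone. -/
def pathGain (γ : ι → ι → ℝ≥0 → ℝ≥0) : ι → List ι → ℝ≥0 → ℝ≥0
  | _, [] => id
  | a, c :: l => γ a c ∘ pathGain γ c l

theorem pathGain_append_cons (a b : ι) (l₁ l₂ : List ι) :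
    pathGain γ a (l₁ ++ b :: l₂) = chainGain γ a l₁ b ∘ pathGain γ b l₂ := by
  induction l₁ generalizing a with
  | nil => rfl
  | cons c l₁ ih => simp only [List.cons_append, pathGain, chainGain, ih, Function.comp_assoc]

theorem chainGain_eq_pathGain (a b : ι) (l : List ι) :
    chainGain γ a l b = pathGain γ a (l ++ [b]) :=
  (pathGain_append_cons a b l []).symm

theorem isClassN_pathGain (hγ : ∀ i j, j ≠ i → IsClassN (γ i j)) {a : ι} {l : List ι}
    (hl : (a :: l).IsChain (· ≠ ·)) : IsClassN (pathGain γ a l) := by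
  induction l generalizing a with
  | nil => exact ⟨monotone_id, continuous_id, rfl⟩
  | cons c l ih =>
    rw [List.isChain_cons_cons] at hl
    exact (hγ a c hl.1.symm).comp (ih hl.2)

theorem chainGain_self_le (hγ : ∀ i j, j ≠ i → IsClassN (γ i j)) (hsg : CyclicSmallGain γ)
    {i : ι} {l : List ι} (hne : l ≠ []) (hl : (i :: l).Nodup) (s : ℝ≥0) :
    chainGain γ i l i s ≤ s := by
  rcases eq_zero_or_pos s with rfl | hs
  · have hcycle : (i :: (l ++ [i])).IsChain (· ≠ ·) := by
      rw [← List.cons_append]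
      refine List.IsChain.append (List.Pairwise.isChain hl) (List.isChain_singleton i) ?_
      simp only [List.getLast?_cons, List.head?_cons, Option.mem_some_iff,
        List.getLast?_eq_some_getLast hne, Option.getD_some, forall_eq']
      exact fun h => (List.nodup_cons.1 hl).1 (h ▸ List.getLast_mem hne)
    rw [chainGain_eq_pathGain, (isClassN_pathGain hγ hcycle).map_zero]
  · have hlen : 2 ≤ (i :: l).length := by
      simpa [Nat.one_le_iff_ne_zero] using hne
    exact (hsg i l hlen hl s hs).le

variable [Fintype ι] [DecidableEq ι]

/-- The lists `l` for which `i :: l` is a path without repetitions. -/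
def simplePathsFrom (i : ι) : Finset (List ι) :=
  (Finset.univ.map (Function.Embedding.subtype List.Nodup)).filter (i ∉ ·)

theorem mem_simplePathsFrom {i : ι} {l : List ι} :
    l ∈ simplePathsFrom i ↔ (i :: l).Nodup := by
  simp [simplePathsFrom, and_comm]

/-- The largest gain along the simple paths starting at `i`, as the `i`-th coordinate of a curve
in `ℝ≥0 ^ ι`. -/
def maxPathGain (γ : ι → ι → ℝ≥0 → ℝ≥0) (s : ℝ≥0) (i : ι) : ℝ≥0 :=
  (simplePathsFrom i).sup fun l => pathGain γ i l s

theorem pathGain_le_maxPathGain {i : ι} {l : List ι} (hl : (i :: l).Nodup) (s : ℝ≥0) :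
    pathGain γ i l s ≤ maxPathGain γ s i :=
  Finset.le_sup (f := fun l => pathGain γ i l s) (mem_simplePathsFrom.2 hl)

theorem isClassN_maxPathGain (hγ : ∀ i j, j ≠ i → IsClassN (γ i j)) (i : ι) :
    IsClassN fun s => maxPathGain γ s i :=
  IsClassN.finset_sup fun _ hl =>
    isClassN_pathGain hγ (List.Pairwise.isChain (mem_simplePathsFrom.1 hl))

theorem le_maxPathGain (s : ℝ≥0) (i : ι) : s ≤ maxPathGain γ s i :=
  pathGain_le_maxPathGain (l := []) (List.nodup_singleton i) s

theorem pathGain_cons_le_maxPathGain (hγ : ∀ i j, j ≠ i → IsClassN (γ i j))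
    (hsg : CyclicSmallGain γ) {i j : ι} (hji : j ≠ i) {l : List ι} (hl : (j :: l).Nodup)
    (s : ℝ≥0) : pathGain γ i (j :: l) s ≤ maxPathGain γ s i := by
  by_cases hi : i ∈ j :: l
  · -- The path returns to `i`; cutting out the cycle does not decrease the gain.
    obtain ⟨l₁, l₂, hsplit⟩ := List.append_of_mem hi
    have hne : l₁ ≠ [] := by
      rintro rfl
      exact hji (List.cons.inj hsplit).1
    rw [hsplit] at hl ⊢
    rw [List.nodup_middle, ← List.cons_append] at hl
    rw [pathGain_append_cons]
    exact (chainGain_self_le hγ hsg hne hl.of_append_left _).trans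
      (pathGain_le_maxPathGain (hl.sublist (by simp)) s)
  · exact pathGain_le_maxPathGain (List.nodup_cons.2 ⟨hi, hl⟩) s

theorem gain_maxPathGain_le (hγ : ∀ i j, j ≠ i → IsClassN (γ i j)) (hsg : CyclicSmallGain γ)
    {i j : ι} (hji : j ≠ i) (s : ℝ≥0) : γ i j (maxPathGain γ s j) ≤ maxPathGain γ s i := by
  obtain ⟨l, hl, hmax⟩ := Finset.exists_mem_eq_sup (simplePathsFrom j)
    ⟨[], mem_simplePathsFrom.2 (List.nodup_singleton j)⟩ fun l => pathGain γ j l s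
  rw [maxPathGain, hmax]
  exact pathGain_cons_le_maxPathGain hγ hsg hji (mem_simplePathsFrom.1 hl) s

/-- The gain operator `N ↦ (max_{j ≠ i} γ_{i,j}(N_j))_i` of max-type small-gain theory. -/
def gainOperator (γ : ι → ι → ℝ≥0 → ℝ≥0) (N : ι → ℝ≥0) (i : ι) : ℝ≥0 :=
  (Finset.univ.filter (fun j => j ≠ i)).sup fun j => γ i j (N j)

theorem gainOperator_le {N : ι → ℝ≥0} {i : ι} {a : ℝ≥0} (h : ∀ j, j ≠ i → γ i j (N j) ≤ a) :
    gainOperator γ N i ≤ a :=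
  Finset.sup_le fun j hj => h j (Finset.mem_filter.1 hj).2

theorem gainOperator_mono (hγ : ∀ i j, j ≠ i → Monotone (γ i j)) {N N' : ι → ℝ≥0} {i : ι}
    (h : ∀ j, j ≠ i → N j ≤ N' j) : gainOperator γ N i ≤ gainOperator γ N' i :=
  Finset.sup_mono_fun fun j hj =>
    have hji : j ≠ i := (Finset.mem_filter.1 hj).2
    hγ i j hji (h j hji)

/-- A curve `σ` of vectors which the gain operator of `γ` contracts by the factor `c`, in the
spirit of the `Ω`-paths of small-gain theory: the boxes `∏ i, [0, σ s i]` form a continuous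
increasing family that exhausts the positive orthant. -/
structure IsContractedPath (γ : ι → ι → ℝ≥0 → ℝ≥0) (c : ℝ≥0) (σ : ℝ≥0 → ι → ℝ≥0) : Prop where
  isClassN : ∀ i, IsClassN fun s => σ s i
  le_apply : ∀ s i, s ≤ σ s i
  gainOperator_le : ∀ s i, gainOperator γ (σ s) i ≤ c * σ s i

theorem isContractedPath_maxPathGain (hγ : ∀ i j, j ≠ i → IsClassN (γ i j)) {ω : ℝ≥0}
    (hω : 1 ≤ ω) (hsg : CyclicSmallGain fun i j s => ω * γ i j (ω * s)) :
    IsContractedPath γ (ω⁻¹ ^ 2)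
      fun s i => ω * maxPathGain (fun i j s => ω * γ i j (ω * s)) s i := by
  have hω₀ : 0 < ω := one_pos.trans_le hω
  have hωγ : ∀ i j, j ≠ i → IsClassN fun s => ω * γ i j (ω * s) := fun i j hji =>
    (IsClassN.const_mul ω).comp ((hγ i j hji).comp (IsClassN.const_mul ω))
  refine ⟨fun i => (IsClassN.const_mul ω).comp (isClassN_maxPathGain hωγ i),
    fun s i => (le_maxPathGain s i).trans (le_mul_of_one_le_left zero_le hω),
    fun s i => gainOperator_le fun j hji => ?_⟩
  rw [pow_two, mul_assoc, inv_mul_cancel_left₀ hω₀.ne', le_inv_mul_iff₀ hω₀]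
  exact gain_maxPathGain_le hωγ hsg hji s

end GainPaths

section Descent

variable {ι : Type*}

theorem exists_pos_sum_le [Fintype ι] {σ : ℝ≥0 → ι → ℝ≥0} (hσ : ∀ i, IsClassN fun s => σ s i)
    {ε : ℝ≥0} (hε : 0 < ε) : ∃ ρ : ℝ≥0, 0 < ρ ∧ ∑ i, σ ρ i ≤ ε := by
  have hcont : Continuous fun s => ∑ i, σ s i :=
    continuous_finsetSum _ fun i _ => (hσ i).continuous
  have hzero : ∑ i, σ 0 i = 0 := Finset.sum_eq_zero fun i _ => (hσ i).map_zero
  have hsmall : ∀ᶠ s in 𝓝 (0 : ℝ≥0), ∑ i, σ s i < ε :=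
    hcont.continuousAt.eventually_lt continuousAt_const (by rwa [hzero])
  have : (𝓝[>] (0 : ℝ≥0)).NeBot := nhdsGT_neBot_of_exists_gt ⟨1, one_pos⟩
  obtain ⟨ρ, hle, hρ⟩ := ((hsmall.filter_mono nhdsWithin_le_nhds).and
    (self_mem_nhdsWithin (s := Set.Ioi 0))).exists
  exact ⟨ρ, hρ, hle.le⟩

theorem mem_of_forall_mul_le_imp_mem [Finite ι] {σ : ℝ≥0 → ι → ℝ≥0} (hmono : Monotone σ)
    (hcont : Continuous σ) (hpos : ∀ s, 0 < s → ∀ i, 0 < σ s i) {κ : ℝ≥0} (hκ : κ < 1)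
    {A : Set ℝ≥0} (hne : A.Nonempty)
    (hstep : ∀ s ∈ A, ∀ s', (∀ i, κ * σ s i ≤ σ s' i) → s' ∈ A) {ρ : ℝ≥0} (hρ : 0 < ρ) :
    ρ ∈ A := by
  by_contra hρA
  have hup : ∀ s ∈ A, ∀ s', s ≤ s' → s' ∈ A := fun s hs s' hss' =>
    hstep s hs s' fun i => (mul_le_of_le_one_left zero_le hκ.le).trans (hmono hss' i)
  have hGLB : IsGLB A (sInf A) := isGLB_csInf hne (OrderBot.bddBelow A)
  have hinf : 0 < sInf A := hρ.trans_le <| le_csInf hne fun s hs =>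
    (not_le.1 fun hsρ => hρA (hup s hs ρ hsρ)).le
  have hcoord : ∀ i, Continuous fun s => σ s i := fun i => (continuous_apply i).comp hcont
  have hlt : ∀ i, κ * σ (sInf A) i < σ (sInf A) i := fun i =>
    mul_lt_of_lt_one_left (hpos _ hinf i) hκ
  have hmem : sInf A ∈ A := by
    have hev : ∀ᶠ s in 𝓝 (sInf A), ∀ i, κ * σ s i < σ (sInf A) i :=
      eventually_all.2 fun i =>
        (continuous_const.mul (hcoord i)).continuousAt.eventually_lt continuousAt_const (hlt i)
    obtain ⟨s, hsA, hs⟩ :=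
      ((hGLB.frequently_mem hne).and_eventually (hev.filter_mono nhdsWithin_le_nhds)).exists
    exact hstep s hsA _ fun i => (hs i).le
  have hev : ∀ᶠ s in 𝓝 (sInf A), ∀ i, κ * σ (sInf A) i < σ s i :=
    eventually_all.2 fun i =>
      continuousAt_const.eventually_lt (hcoord i).continuousAt (hlt i)
  have : (𝓝[<] sInf A).NeBot := nhdsLT_neBot_of_exists_lt ⟨0, hinf⟩
  obtain ⟨s, hs, hslt⟩ := ((hev.filter_mono nhdsWithin_le_nhds).and
    (self_mem_nhdsWithin (s := Set.Iio (sInf A)))).exists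
  exact (hGLB.1 (hstep _ hmem s fun i => (hs i).le)).not_gt hslt

end Descent

section DelayEquations

variable {r T : ℝ}

theorem wellFounded_delay (hr : 0 < r) : WellFounded fun s t : ℝ => 0 < t ∧ s ≤ t - r := by
  refine Subrelation.wf (fun {s t} h => ?_) (measure fun t : ℝ => ⌈t / r⌉₊).wf
  obtain ⟨ht, hst⟩ := h
  change ⌈s / r⌉₊ < ⌈t / r⌉₊
  have hle : s / r + 1 ≤ t / r := by
    rw [div_add_one hr.ne']
    gcongr
    linarith
  rcases le_or_gt s 0 with hs | hs
  · rw [Nat.ceil_eq_zero.2 (div_nonpos_of_nonpos_of_nonneg hs hr.le)]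
    exact Nat.ceil_pos.2 (div_pos ht hr)
  · rw [← Nat.add_one_le_iff, ← Nat.ceil_add_one (div_pos hs hr).le]
    exact Nat.ceil_mono hle

/-- The functional `Φ` is retarded: for `t > 0` the value `Φ x t` depends only on the restriction
of `x` to `[t - T, t - r]`. -/
def DependsOnWindow {E : Type*} (r T : ℝ) (Φ : (ℝ → E) → ℝ → E) : Prop :=
  ∀ x y t, 0 < t → Set.EqOn x y (Set.Icc (t - T) (t - r)) → Φ x t = Φ y t

namespace DependsOnWindow

variable {E : Type*} {Φ : (ℝ → E) → ℝ → E}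

theorem exists_solution (hΦ : DependsOnWindow r T Φ) (hr : 0 < r) (x₀ : ℝ → E) :
    ∃ x, (∀ t, t ≤ 0 → x t = x₀ t) ∧ ∀ t, 0 < t → x t = Φ x t := by
  let step (t : ℝ) (x : ∀ s, 0 < t ∧ s ≤ t - r → E) : E :=
    if 0 < t then Φ (fun s => if h : 0 < t ∧ s ≤ t - r then x s h else x₀ s) t else x₀ t
  have hfix : ∀ t, (wellFounded_delay hr).fix step t =
      step t fun s _ => (wellFounded_delay hr).fix step s := (wellFounded_delay hr).fix_eq step
  refine ⟨(wellFounded_delay hr).fix step, fun t ht => ?_, fun t ht => ?_⟩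
  · rw [hfix]
    exact if_neg ht.not_gt
  · rw [hfix]
    exact (if_pos ht).trans (hΦ _ _ t ht fun s hs => dif_pos ⟨ht, hs.2⟩)

theorem eqOn_of_eqOn (hΦ : DependsOnWindow r T Φ) (hr : 0 < r) {x y : ℝ → E}
    (hx : ∀ t, 0 < t → x t = Φ x t) (hy : ∀ t, 0 < t → y t = Φ y t)
    (h₀ : Set.EqOn x y (Set.Icc (-T) 0)) : Set.EqOn x y (Set.Ici (-T)) := by
  intro t
  induction t using (wellFounded_delay hr).induction with
  | _ t ih =>
    intro ht
    rcases le_or_gt t 0 with h | h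
    · exact h₀ ⟨ht, h⟩
    · rw [hx t h, hy t h]
      exact hΦ x y t h fun s hs => ih s ⟨h, hs.2⟩ (by linarith [hs.1] : -T ≤ s)

end DependsOnWindow

end DelayEquations

section DelayInequalities

variable {ι : Type*} [Fintype ι] [DecidableEq ι] {γ : ι → ι → ℝ≥0 → ℝ≥0} {r T Θ : ℝ}
  {v : ℝ → ι → ℝ}

/-- The delay inequality
`v_i(t) ≤ θ v_i(t - τ) + (1 - θ) max_{j ≠ i} γ_{i,j}(sup_{[t-T,t-r]} v_j)` for `t > 0`, with some
`θ ∈ [0, Θ]` and `τ ∈ [r, T]` depending on `i` and `t`. The suprema are replaced by arbitrary upper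
bounds `N j`, which avoids the junk value of `sSup` on unbounded sets. -/
def SatisfiesDelayInequality (γ : ι → ι → ℝ≥0 → ℝ≥0) (r T Θ : ℝ) (v : ℝ → ι → ℝ) : Prop :=
  ∀ t, 0 < t → ∀ i, ∃ θ ∈ Set.Icc 0 Θ, ∃ τ ∈ Set.Icc r T, ∀ N : ι → ℝ≥0,
    (∀ s ∈ Set.Icc (t - T) (t - r), ∀ j, v s j ≤ N j) →
      v t i ≤ θ * v (t - τ) i + (1 - θ) * gainOperator γ N i

namespace SatisfiesDelayInequality

theorem le_of_gainOperator_le (hv : SatisfiesDelayInequality γ r T Θ v) (hr : 0 < r) (hΘ : Θ ≤ 1)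
    {N : ι → ℝ≥0} (hN : ∀ i, gainOperator γ N i ≤ N i)
    (hinit : ∀ t ∈ Set.Icc (-T) 0, ∀ i, v t i ≤ N i) (t : ℝ) (ht : -T ≤ t) (i : ι) :
    v t i ≤ N i := by
  induction t using (wellFounded_delay hr).induction generalizing i with
  | _ t ih =>
    rcases le_or_gt t 0 with h | h
    · exact hinit t ⟨ht, h⟩ i
    obtain ⟨θ, hθ, τ, hτ, hvt⟩ := hv t h i
    have hpast : ∀ s ∈ Set.Icc (t - T) (t - r), ∀ j, v s j ≤ N j := fun s hs =>
      ih s ⟨h, hs.2⟩ (by linarith [hs.1])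
    have hθ₁ : 0 ≤ 1 - θ := by linarith [hθ.2]
    calc v t i ≤ θ * v (t - τ) i + (1 - θ) * gainOperator γ N i := hvt N hpast
      _ ≤ θ * N i + (1 - θ) * N i := by
        gcongr
        · exact hθ.1
        · exact hpast _ ⟨by linarith [hτ.2], by linarith [hτ.1]⟩ i
        · exact hN i
      _ = N i := by ring

theorem le_geometric (hv : SatisfiesDelayInequality γ r T Θ v) (hT : 0 < T) (hΘ : Θ ≤ 1)
    {N : ι → ℝ≥0} {c : ℝ≥0} (hc : c ≤ 1) (hN : ∀ i, gainOperator γ N i ≤ c * N i) {t₁ : ℝ}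
    (ht₁ : 0 ≤ t₁) (hbound : ∀ t, t₁ ≤ t → ∀ i, v t i ≤ N i) (m : ℕ) {t : ℝ}
    (ht : t₁ + m * T ≤ t) (i : ι) : v t i ≤ (c + Θ ^ m * (1 - c)) * N i := by
  induction m generalizing t with
  | zero => simpa using hbound t (by simpa using ht) i
  | succ m ih =>
    push_cast at ht
    have hmT : 0 ≤ m * T := by positivity
    obtain ⟨θ, hθ, τ, hτ, hvt⟩ := hv t (by linarith) i
    have hθ₁ : 0 ≤ 1 - θ := by linarith [hθ.2]
    have hc₁ : (0 : ℝ) ≤ 1 - c := sub_nonneg.2 (by exact_mod_cast hc)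
    have hΘ₀ : 0 ≤ Θ := hθ.1.trans hθ.2
    have hgain : (gainOperator γ N i : ℝ) ≤ c * N i := by exact_mod_cast hN i
    calc v t i ≤ θ * v (t - τ) i + (1 - θ) * gainOperator γ N i :=
          hvt N fun s hs => hbound s (by linarith [hs.1])
      _ ≤ θ * ((c + Θ ^ m * (1 - c)) * N i) + (1 - θ) * (c * N i) := by
          gcongr
          · exact hθ.1
          · exact ih (by linarith [hτ.2])
      _ = (c + θ * (Θ ^ m * (1 - c))) * N i := by ring
      _ ≤ (c + Θ * (Θ ^ m * (1 - c))) * N i := by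
          gcongr
          exact hθ.2
      _ = (c + Θ ^ (m + 1) * (1 - c)) * N i := by ring

variable {σ : ℝ≥0 → ι → ℝ≥0} {c : ℝ≥0}

theorem le_path (hv : SatisfiesDelayInequality γ r T Θ v) (hr : 0 < r) (hΘ : Θ ≤ 1)
    (hσ : IsContractedPath γ c σ) (hc : c ≤ 1) {ρ : ℝ≥0}
    (hinit : ∀ t ∈ Set.Icc (-T) 0, ∀ i, v t i ≤ ρ) (t : ℝ) (ht : -T ≤ t) (i : ι) :
    v t i ≤ σ ρ i :=
  hv.le_of_gainOperator_le hr hΘ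
    (fun i => (hσ.gainOperator_le ρ i).trans (mul_le_of_le_one_left zero_le hc))
    (fun t ht i => (hinit t ht i).trans (by exact_mod_cast hσ.le_apply ρ i)) t ht i

theorem exists_time_forall_le_path (hr : 0 < r) (hT : 0 < T) (hΘ : Θ < 1)
    (hσ : IsContractedPath γ c σ) (hc : c < 1) (R : ℝ≥0) {ρ : ℝ≥0} (hρ : 0 < ρ) :
    ∃ t₁ : ℝ, 0 ≤ t₁ ∧ ∀ v, SatisfiesDelayInequality γ r T Θ v →
      (∀ t ∈ Set.Icc (-T) 0, ∀ i, v t i ≤ R) → ∀ t, t₁ ≤ t → ∀ i, v t i ≤ σ ρ i := by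
  let A : Set ℝ≥0 := {ρ | ∃ t₁ : ℝ, 0 ≤ t₁ ∧ ∀ v, SatisfiesDelayInequality γ r T Θ v →
    (∀ t ∈ Set.Icc (-T) 0, ∀ i, v t i ≤ R) → ∀ t, t₁ ≤ t → ∀ i, v t i ≤ σ ρ i}
  have hR : R ∈ A := ⟨0, le_rfl, fun v hv hinit t ht =>
    hv.le_path hr hΘ.le hσ hc.le hinit t (by linarith)⟩
  obtain ⟨m, hm⟩ := exists_pow_lt_of_lt_one (one_half_pos (α := ℝ)) hΘ
  have hκ : (c + 1) / 2 < 1 := by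
    rw [div_lt_one two_pos, ← one_add_one_eq_two]
    gcongr
  refine mem_of_forall_mul_le_imp_mem (A := A)
    (fun s s' h i => (hσ.isClassN i).monotone h)
    (continuous_pi fun i => (hσ.isClassN i).continuous)
    (fun s hs i => hs.trans_le (hσ.le_apply s i)) hκ ⟨R, hR⟩ ?_ hρ
  rintro s ⟨t₁, ht₁, hs⟩ s' hs'
  refine ⟨t₁ + m * T, by positivity, fun v hv hinit t ht i => ?_⟩
  have hc₁ : (0 : ℝ) ≤ 1 - c := sub_nonneg.2 (by exact_mod_cast hc.le)
  calc v t i ≤ (c + Θ ^ m * (1 - c)) * σ s i :=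
        hv.le_geometric hT hΘ.le hc.le (hσ.gainOperator_le s) ht₁ (hs v hv hinit) m ht i
    _ ≤ (c + 1 / 2 * (1 - c)) * σ s i := by gcongr
    _ = ((c + 1) / 2 : ℝ≥0) * σ s i := by push_cast; ring
    _ ≤ σ s' i := by exact_mod_cast hs' i

end SatisfiesDelayInequality

end DelayInequalities

theorem norm_sub_le_of_forall_norm_sub_le {F : Type*} [NormedAddCommGroup F]
    [InnerProductSpace ℝ F] {K : Set F} (hK : Convex ℝ K) {u v w : F} (hv : v ∈ K) (hw : w ∈ K)
    (hmin : ∀ z ∈ K, ‖u - v‖ ≤ ‖u - z‖) : ‖v - w‖ ≤ ‖u - w‖ := by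
  have : Nonempty K := ⟨⟨v, hv⟩⟩
  have hinf : ‖u - v‖ = ⨅ z : K, ‖u - z‖ :=
    le_antisymm (le_ciInf fun z => hmin z z.2)
      (ciInf_le ⟨0, Set.forall_mem_range.2 fun _ => norm_nonneg _⟩ (⟨v, hv⟩ : K))
  have hobtuse : inner ℝ (u - v) (w - v) ≤ 0 :=
    (norm_eq_iInf_iff_real_inner_le_zero hK hv).1 hinf w hw
  have hexpand := norm_sub_sq_real (u - v) (w - v)
  rw [sub_sub_sub_cancel_right] at hexpand
  rw [norm_sub_rev v w]
  exact (sq_le_sq₀ (norm_nonneg _) (norm_nonneg _)).1 (by linarith [sq_nonneg ‖u - v‖])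

section SupNorm

variable {E : Type*} {x y : ℝ → E} {a b : ℝ}

theorem supNormOn_le [Norm E] {C : ℝ} (hC : 0 ≤ C) (h : ∀ s ∈ Set.Icc a b, ‖x s‖ ≤ C) :
    supNormOn x a b ≤ C :=
  Real.sSup_le (Set.forall_mem_image.2 h) hC

theorem supNormOn_nonneg [SeminormedAddGroup E] (x : ℝ → E) (a b : ℝ) : 0 ≤ supNormOn x a b :=
  Real.sSup_nonneg (Set.forall_mem_image.2 fun _ _ => norm_nonneg _)

theorem supNormOn_congr [Norm E] (h : Set.EqOn x y (Set.Icc a b)) :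
    supNormOn x a b = supNormOn y a b :=
  congrArg sSup (Set.image_congr fun s hs => by rw [h hs])

end SupNorm

theorem norm_le_sum_of_forall_norm_apply_le {p : ENNReal} [Fact (1 ≤ p)] {ι : Type*} [Fintype ι]
    {E : ι → Type*} [∀ i, SeminormedAddCommGroup (E i)] {v : PiLp p E} {N : ι → ℝ≥0}
    (h : ∀ i, ‖v i‖ ≤ N i) : ‖v‖ ≤ (∑ i, N i : ℝ≥0) := by
  classical
  have hsum : v = ∑ i, PiLp.single p i (v i) := by
    simp only [PiLp.single, ← WithLp.toLp_sum, Finset.univ_sum_single]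
  rw [NNReal.coe_sum]
  calc ‖v‖ = ‖∑ i, PiLp.single p i (v i)‖ := congrArg norm hsum
    _ ≤ ∑ i, (N i : ℝ) :=
      norm_sum_le_of_le _ fun i _ => (PiLp.norm_single p E i (v i)).trans_le (h i)

theorem StrategicGame.norm_proj_sub_le {n : ℕ} {k : Fin n → ℕ} (G : StrategicGame n k) {i : Fin n}
    (v : EuclideanSpace ℝ (Fin (k i))) (w : G.S i) :
    ‖(G.proj i v).1 - w.1‖ ≤ ‖v - w.1‖ :=
  norm_sub_le_of_forall_norm_sub_le (G.convex i) (G.proj i v).2 w.2 fun z hz =>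
    (exists_nearest_point (G.nonempty i) (G.isClosed i) (G.convex i) v).choose_spec ⟨z, hz⟩

section BestReplyDynamics

variable {n : ℕ} {k : Fin n → ℕ} {G : StrategicGame n k} {f : G.ReplyMap} {qs : G.Outcome}
  {γ : Fin n → Fin n → ℝ≥0 → ℝ≥0} {r T Θ : ℝ} {u : UncertainInputs k r T Θ}
  {x x₀ : ℝ → Deviation k}

theorem dependsOnWindow_fdeRhs :
    DependsOnWindow r T fun x t => WithLp.toLp 2 (fdeRhs G f qs u x t) := by
  intro x y t ht hxy
  refine congrArg (WithLp.toLp 2) (funext fun i => ?_)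
  have hτ := u.τ_mem i t ht.le
  have hdelay : x (t - u.τ i t) = y (t - u.τ i t) :=
    hxy ⟨by linarith [hτ.2], by linarith [hτ.1]⟩
  have hsup : ∀ j, supNormOn (fun s => x s j) (t - T) (t - r) =
      supNormOn (fun s => y s j) (t - T) (t - r) := fun j =>
    supNormOn_congr fun s hs => by simp only [hxy hs]
  simp only [fdeRhs, hdelay, hsup]

theorem norm_expectation_sub_le {j : Fin n} {y : ℝ → EuclideanSpace ℝ (Fin (k j))} {a b : ℝ}
    {d : EuclideanSpace ℝ (Fin (k j))} (hd : ‖d‖ ≤ 1) :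
    ‖(G.proj j ((qs j).1 + supNormOn y a b • d)).1 - (qs j).1‖ ≤ supNormOn y a b := by
  refine (G.norm_proj_sub_le _ _).trans ?_
  rw [add_sub_cancel_left, norm_smul, Real.norm_of_nonneg (supNormOn_nonneg _ _ _)]
  exact mul_le_of_le_one_right (supNormOn_nonneg _ _ _) hd

theorem satisfiesDelayInequality_norm (hγ : ∀ i j, j ≠ i → Monotone (γ i j))
    (hbound : ∀ (q : G.Outcome) (i : Fin n), ‖(f i (StrategicGame.others q i)).1 - (qs i).1‖₊ ≤
      gainOperator γ (fun j => ‖(q j).1 - (qs j).1‖₊) i)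
    (hΘ : Θ ≤ 1) (hx : ∀ t, 0 < t → ∀ i, x t i = fdeRhs G f qs u x t i) :
    SatisfiesDelayInequality γ r T Θ fun t i => ‖x t i‖ := by
  intro t ht i
  have hθ := u.θ_mem i t ht.le
  have hθ₁ : 0 ≤ 1 - u.θ i t := by linarith [hθ.2]
  refine ⟨u.θ i t, hθ, u.τ i t, u.τ_mem i t ht.le, fun N hN => ?_⟩
  let q : G.Outcome := fun j => G.proj j ((qs j).1 +
    supNormOn (fun s => x s j) (t - T) (t - r) • u.d i j t)
  have hq : ∀ j, j ≠ i → ‖(q j).1 - (qs j).1‖₊ ≤ N j := fun j hji =>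
    (norm_expectation_sub_le (u.d_le i j t hji ht.le)).trans
      (supNormOn_le (N j).coe_nonneg fun s hs => hN s hs j)
  have hreply : ‖(f i (StrategicGame.others q i)).1 - (qs i).1‖ ≤ gainOperator γ N i :=
    (hbound q i).trans (gainOperator_mono hγ hq)
  have hinertia : ‖(G.proj i (x (t - u.τ i t) i + (qs i).1)).1 - (qs i).1‖ ≤
      ‖x (t - u.τ i t) i‖ := by
    simpa only [add_sub_cancel_right] using G.norm_proj_sub_le (x (t - u.τ i t) i + (qs i).1) (qs i)
  calc ‖x t i‖ = ‖fdeRhs G f qs u x t i‖ := by rw [hx t ht i]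
    _ ≤ u.θ i t * ‖(G.proj i (x (t - u.τ i t) i + (qs i).1)).1 - (qs i).1‖ +
        (1 - u.θ i t) * ‖(f i (StrategicGame.others q i)).1 - (qs i).1‖ := by
      refine (norm_add_le _ _).trans_eq ?_
      rw [norm_smul, norm_smul, Real.norm_of_nonneg hθ.1, Real.norm_of_nonneg hθ₁]
      rfl
    _ ≤ u.θ i t * ‖x (t - u.τ i t) i‖ + (1 - u.θ i t) * gainOperator γ N i := by
      gcongr
      exact hθ.1

theorem norm_apply_le_of_supNormOn_le (hx₀ : IsInitialState T x₀) {R : ℝ}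
    (hR : supNormOn x₀ (-T) 0 ≤ R) (hinit : Set.EqOn x x₀ (Set.Icc (-T) 0)) {t : ℝ}
    (ht : t ∈ Set.Icc (-T) 0) (i : Fin n) : ‖x t i‖ ≤ R := by
  rw [hinit ht]
  exact (PiLp.norm_apply_le _ i).trans ((le_csSup hx₀ (Set.mem_image_of_mem _ ht)).trans hR)

theorem supNormOn_le_sum {N : Fin n → ℝ≥0} {a b : ℝ}
    (h : ∀ s ∈ Set.Icc a b, ∀ i, ‖x s i‖ ≤ N i) : supNormOn x a b ≤ (∑ i, N i : ℝ≥0) :=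
  supNormOn_le (NNReal.coe_nonneg _) fun s hs => norm_le_sum_of_forall_norm_apply_le (h s hs)

theorem exists_isSolution (hr : 0 < r)
    (hbdd : ∀ x : ℝ → Deviation k, Set.EqOn x x₀ (Set.Icc (-T) 0) →
      (∀ t, 0 < t → ∀ i, x t i = fdeRhs G f qs u x t i) →
        ∃ N : Fin n → ℝ≥0, ∀ t, -T ≤ t → ∀ i, ‖x t i‖ ≤ N i) :
    ∃ x, IsSolution G f qs u x₀ x := by
  obtain ⟨x, hinit, hx⟩ :=
    (dependsOnWindow_fdeRhs (G := G) (f := f) (qs := qs) (u := u)).exists_solution hr x₀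
  have hinit' : Set.EqOn x x₀ (Set.Icc (-T) 0) := fun t ht => hinit t ht.2
  have hx' : ∀ t, 0 < t → ∀ i, x t i = fdeRhs G f qs u x t i := fun t ht i =>
    congrArg (fun w : Deviation k => w i) (hx t ht)
  obtain ⟨N, hN⟩ := hbdd x hinit' hx'
  exact ⟨x, hinit', fun t ht => ⟨_, Set.forall_mem_image.2 fun s hs =>
    norm_le_sum_of_forall_norm_apply_le (hN s (by linarith [hs.1]))⟩, hx'⟩

theorem IsSolution.eqOn (hr : 0 < r) {y : ℝ → Deviation k} (hx : IsSolution G f qs u x₀ x)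
    (hy : IsSolution G f qs u x₀ y) : Set.EqOn x y (Set.Ici (-T)) :=
  dependsOnWindow_fdeRhs.eqOn_of_eqOn hr (fun t ht => PiLp.ext (hx.eqn t ht))
    (fun t ht => PiLp.ext (hy.eqn t ht)) fun t ht => (hx.init t ht).trans (hy.init t ht).symm

theorem isRGAS_of_isContractedPath (hγ : ∀ i j, j ≠ i → Monotone (γ i j))
    (hbound : ∀ (q : G.Outcome) (i : Fin n), ‖(f i (StrategicGame.others q i)).1 - (qs i).1‖₊ ≤
      gainOperator γ (fun j => ‖(q j).1 - (qs j).1‖₊) i)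
    {c : ℝ≥0} {σ : ℝ≥0 → Fin n → ℝ≥0} (hσ : IsContractedPath γ c σ) (hc : c < 1)
    (hr : 0 < r) (hT : 0 < T) (hΘ : Θ < 1) : IsRGAS G f qs r T Θ := by
  have hdelay : ∀ (u : UncertainInputs k r T Θ) (x : ℝ → Deviation k),
      (∀ t, 0 < t → ∀ i, x t i = fdeRhs G f qs u x t i) →
        SatisfiesDelayInequality γ r T Θ fun t i => ‖x t i‖ :=
    fun u x => satisfiesDelayInequality_norm hγ hbound hΘ.le
  have hbox : ∀ (ρ : ℝ≥0) (u : UncertainInputs k r T Θ) (x₀ x : ℝ → Deviation k),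
      IsInitialState T x₀ → supNormOn x₀ (-T) 0 ≤ ρ → Set.EqOn x x₀ (Set.Icc (-T) 0) →
        (∀ t, 0 < t → ∀ i, x t i = fdeRhs G f qs u x t i) →
          ∀ t, -T ≤ t → ∀ i, ‖x t i‖ ≤ σ ρ i :=
    fun ρ u x₀ x hx₀ hρ hinit hx => (hdelay u x hx).le_path hr hΘ.le hσ hc.le
      fun t ht => norm_apply_le_of_supNormOn_le hx₀ hρ hinit ht
  have hstate : ∀ (ρ : ℝ≥0) (u : UncertainInputs k r T Θ) (x₀ x : ℝ → Deviation k),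
      IsInitialState T x₀ → supNormOn x₀ (-T) 0 ≤ ρ → IsSolution G f qs u x₀ x →
        ∀ t, 0 ≤ t → supNormOn x (t - T) t ≤ (∑ i, σ ρ i : ℝ≥0) :=
    fun ρ u x₀ x hx₀ hρ hx t ht => supNormOn_le_sum fun s hs =>
      hbox ρ u x₀ x hx₀ hρ hx.init hx.eqn s (by linarith [hs.1])
  refine ⟨fun u x₀ hx₀ => ?_, fun u x₀ x y _ hx hy t ht => hx.eqOn hr hy ht,
    fun R hR => ?_, fun ε hε => ?_, fun ε R hε hR => ?_⟩
  · exact exists_isSolution hr fun x hinit hx =>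
      ⟨_, hbox ⟨_, supNormOn_nonneg x₀ (-T) 0⟩ u x₀ x hx₀ le_rfl hinit hx⟩
  · exact ⟨_, hstate ⟨R, hR⟩⟩
  · obtain ⟨ρ, hρ, hsum⟩ := exists_pos_sum_le hσ.isClassN (ε := ⟨ε, hε.le⟩) hε
    exact ⟨ρ, hρ, fun u x₀ x hx₀ hxρ hx t ht => (hstate ρ u x₀ x hx₀ hxρ hx t ht).trans hsum⟩
  · obtain ⟨ρ, hρ, hsum⟩ := exists_pos_sum_le hσ.isClassN (ε := ⟨ε, hε.le⟩) hε
    obtain ⟨t₁, ht₁, htail⟩ := SatisfiesDelayInequality.exists_time_forall_le_path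
      hr hT hΘ hσ hc ⟨R, hR⟩ hρ
    refine ⟨t₁ + T, by linarith, fun u x₀ x hx₀ hxR hx t ht => ?_⟩
    have hsettled : ∀ s, t₁ ≤ s → ∀ i, ‖x s i‖ ≤ σ ρ i :=
      htail _ (hdelay u x hx.eqn) fun s hs => norm_apply_le_of_supNormOn_le hx₀ hxR hx.init hs
    exact (supNormOn_le_sum fun s hs => hsettled s (by linarith [hs.1])).trans hsum

end BestReplyDynamics

theorem theorem3p1 {n : ℕ} {k : Fin n → ℕ} (G : StrategicGame n k) (f : G.ReplyMap)
    (hf : G.IsBestReply f) (qs : G.Outcome) (hqs : G.IsNash f qs)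
    (γt : Fin n → Fin n → ℝ≥0 → ℝ≥0) (hγt : ∀ i j, j ≠ i → IsClassN (γt i j))
    (hbound : ∀ (q : G.Outcome) (i : Fin n),
      ‖(f i (StrategicGame.others q i)).1 - (qs i).1‖₊ ≤
        (Finset.univ.filter (fun j => j ≠ i)).sup fun j => γt i j ‖(q j).1 - (qs j).1‖₊)
    (ω : ℝ≥0) (hω : 1 < ω)
    (hsg : CyclicSmallGain fun i j s => ω * γt i j (ω * s))
    (r T Θ : ℝ) (hr : 0 < r) (hrT : r ≤ T) (hΘ0 : 0 ≤ Θ) (hΘ1 : Θ < 1) :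
    IsRGAS G f qs r T Θ := by
  have hc : ω⁻¹ ^ 2 < 1 := pow_lt_one₀ zero_le (inv_lt_one_of_one_lt₀ hω) two_ne_zero
  exact isRGAS_of_isContractedPath (fun i j hji => (hγt i j hji).monotone) hbound
    (isContractedPath_maxPathGain hγt hω.le hsg) hc hr (hr.trans_le hrT) hΘ1
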